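/- Let $\mathbb{N}_+^\times$ be the multiplicative monoid of strictly positive integers and let $\mathsf{C}$ be the category with one object $\bullet$ and $\mathrm{End}(\bullet)=\mathbb{N}_+^\times$. Let $\mathsf{D}$ be the poset category with objects $[k]$, $k\in\mathbb{N}_+$, and exactly one arrow $[k]\to[l]$ if $l\mid k$ (and none otherwise), and let $\pi:\mathsf{D}\to\mathsf{C}$ be the functor sending $[k]\to[l]$ to the endomorphism $k/l$. For a small category $\mathsf{A}$ let $\widehat{\mathsf{A}}$ be the topos of presheaves of sets on $\mathsf{A}$, and let $\mathrm{pts}(\widehat{\mathsf{A}})$ be the set of isomorphism classes of points of $\widehat{\mathsf{A}}$, i.e. of geometric morphisms $p:\mathbf{Sets}\to\widehat{\mathsf{A}}$, where $p\cong q$ if $p^*$ and $q^*$ are naturally isomorphic. A flat functor $A:\mathsf{A}\to\mathbf{Sets}$ defines a point with inverse image $-\otimes_{\mathsf{A}}A$ and direct image $S\mapsto \mathrm{Hom}(A(-),S)$. Let $\mathbb{S}$ be the set of supernatural numbers $s=\prod_p p^{s_p}$, $s_p\in\mathbb{N}\cup\{\infty\}$, and write $s\sim s'$ if $s_p=\infty\Leftrightarrow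 s'_p=\infty$ for all primes $p$, and $s_p=s'_p$ for all but finitely many $p$. For $s\in\mathbb{S}$ let $p(s)$ be the point of $\widehat{\mathsf{D}}$ given by the flat functor $P_s$ with $P_s([k])$ a singleton if $k\mid s$ and empty otherwise, and let $q(s)$ be the point of $\widehat{\mathsf{C}}$ given by the flat functor $\mathbb{Q}_+(s)=\{n/k \mid n,k\in\mathbb{N}_+,\ k\mid s\}$, on which $\mathbb{N}_+^\times$ acts by multiplication. **Theorem.** The assignment $s\mapsto p(s)$ induces a bijection $\mathbb{S}\cong\mathrm{pts}(\widehat{\mathsf{D}})$, and $[s]\mapsto q(s)$ is well defined and induces a bijection $\mathbb{S}/{\sim}\cong\mathrm{pts}(\widehat{\mathsf{C}})$. Let $(\pi^*\dashv\pi_*):\widehat{\mathsf{D}}\to\widehat{\mathsf{C}}$ be the geometric morphism induced by $\pi$, where $\pi^*$ is composition with $\pi$. Then for every $s\in\mathbb{S}$ the functor $p(s)^*\circ\pi^*$ is naturally isomorphic to $-\otimes_{\mathsf{C}}\mathbb{Q}_+(s)$. Consequently, under the two bijections, the map $$\mathbb{S}=\mathrm{pts}(\widehat{\mathsf{D}})\longrightarrow\mathrm{pts}(\widehat{\mathsf{C}})=\mathbb{S}/{\sim}$$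 induced by composition with $(\pi^*\dashv\pi_*)$ sends each supernatural number $s$ to its equivalence class $[s]$. -/

import Mathlib

open CategoryTheory Limits Opposite

namespace ArithmeticSite

/-! ## Geometric morphisms and points -/

/-- A geometric morphism `E → F`: a direct image functor `E ⥤ F` together with a left adjoint, the
inverse image functor `F ⥤ E`, which preserves finite limits. -/
structure GeometricMorphism (E : Type*) [Category E] (F : Type*) [Category F] where
  /-- the direct image functor -/
  directImage : E ⥤ F
  /-- the inverse image functor -/
  inverseImage : F ⥤ E
  /-- the inverse image is left adjoint to the direct image -/
  adj : inverseImage ⊣ directImage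
  /-- the inverse image is left exact -/
  leftExact : PreservesFiniteLimits inverseImage

/-- The composite `E → F → G` of two geometric morphisms. -/
def GeometricMorphism.comp {E F G : Type*} [Category E] [Category F] [Category G]
    (f : GeometricMorphism E F) (g : GeometricMorphism F G) : GeometricMorphism E G where
  directImage := f.directImage ⋙ g.directImage
  inverseImage := g.inverseImage ⋙ f.inverseImage
  adj := g.adj.comp f.adj
  leftExact :=
    haveI := f.leftExact
    haveI := g.leftExact
    comp_preservesFiniteLimits _ _

/-- The topos of presheaves of sets on a small category. -/
abbrev PSh (C : Type) [SmallCategory C] := Cᵒᵖ ⥤ Type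

/-- A point of the presheaf topos on `C`: a geometric morphism from the topos of sets to it. -/
abbrev Point (C : Type) [SmallCategory C] := GeometricMorphism Type (PSh C)

/-- Two points are isomorphic if their inverse image functors are naturally isomorphic. -/
instance pointSetoid (C : Type) [SmallCategory C] : Setoid (Point C) where
  r p q := Nonempty (p.inverseImage ≅ q.inverseImage)
  iseqv :=
    { refl := fun _ => ⟨Iso.refl _⟩
      symm := fun ⟨e⟩ => ⟨e.symm⟩
      trans := fun ⟨e⟩ ⟨e'⟩ => ⟨e.trans e'⟩ }

/-- `pts` of the presheaf topos on `C`: the isomorphism classes of points. -/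
def Pts (C : Type) [SmallCategory C] := Quotient (pointSetoid C)

/-- The map on isomorphism classes of points given by composition with a geometric morphism. -/
def Pts.map {C D : Type} [SmallCategory C] [SmallCategory D]
    (f : GeometricMorphism (PSh D) (PSh C)) : Pts D → Pts C :=
  Quotient.map (fun p => p.comp f) (fun _ _ ⟨e⟩ => ⟨Functor.isoWhiskerLeft f.inverseImage e⟩)

/-- The geometric morphism between presheaf toposes induced by a functor `L : D ⥤ C`. Its inverse
image is composition with `L`, its direct image is right Kan extension along `L`. -/
noncomputable def inducedMorphism {D C : Type} [SmallCategory D] [SmallCategory C] (L : D ⥤ C) :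
    GeometricMorphism (PSh D) (PSh C) where
  directImage := L.op.ran
  inverseImage := (Functor.whiskeringLeft Dᵒᵖ Cᵒᵖ Type).obj L.op
  adj := L.op.ranAdjunction Type
  leftExact := inferInstance

/-! ## Points from flat functors -/

section Tensor

variable {C : Type} [SmallCategory C]

/-- The relation generating the tensor product `G ⊗ A`:
`(g · u) ⊗ a = g ⊗ (u · a)` for `g ∈ G(c')`, `a ∈ A(c)` and `u : c ⟶ c'`. -/
def TensorRel (G : PSh C) (A : C ⥤ Type) (x y : Σ c : C, G.obj (op c) × A.obj c) : Prop :=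
  ∃ u : x.1 ⟶ y.1, x.2.1 = G.map u.op y.2.1 ∧ y.2.2 = A.map u x.2.2

/-- The tensor product `G ⊗_C A` of a presheaf `G` with a covariant functor `A`: the quotient of
the disjoint union of the sets `G(c) × A(c)` by the equivalence relation generated by
`TensorRel`. -/
def TensorObj (G : PSh C) (A : C ⥤ Type) : Type := Quot (TensorRel G A)

/-- The functor `- ⊗_C A` from presheaves to sets. -/
def tensor (A : C ⥤ Type) : PSh C ⥤ Type where
  obj G := TensorObj G A
  map {G H} φ := TypeCat.ofHom (Quot.map (fun x => ⟨x.1, φ.app (op x.1) x.2.1, x.2.2⟩) (by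
    rintro ⟨c, g, a⟩ ⟨c', g', a'⟩ ⟨u, hu, hu'⟩
    refine ⟨u, ?_, hu'⟩
    dsimp at hu ⊢
    rw [hu]
    exact NatTrans.naturality_apply φ u.op g'))
  map_id G := by
    ext x
    induction x using Quot.ind
    rfl
  map_comp φ ψ := by
    ext x
    induction x using Quot.ind
    rfl

/-- The functor `Hom_C(A, -)` from sets to presheaves, `S ↦ (c ↦ Hom(A(c), S))`. -/
def homFunctor (A : C ⥤ Type) : Type ⥤ PSh C where
  obj S :=
    { obj := fun c => (A.obj c.unop → S)
      map := fun u => TypeCat.ofHom (fun f a => f (A.map u.unop a))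
      map_id := fun c => by ext f a; simp
      map_comp := fun u v => by ext f a; simp }
  map h := { app := fun c => TypeCat.ofHom (fun f a => h (f a)) }

/-- The adjunction between `- ⊗_C A` and `Hom_C(A, -)`. -/
def tensorAdjunction (A : C ⥤ Type) : tensor A ⊣ homFunctor A :=
  Adjunction.mkOfHomEquiv
    { homEquiv := fun G S =>
        { toFun := fun f =>
            { app := fun c => TypeCat.ofHom (fun g a => f (Quot.mk _ ⟨c.unop, g, a⟩))
              naturality := fun c c' u => by
                ext g
                funext a
                exact congrArg f (Quot.sound ⟨u.unop, rfl, rfl⟩) }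
          invFun := fun φ => TypeCat.ofHom (Quot.lift (fun x => φ.app (op x.1) x.2.1 x.2.2) (by
            rintro ⟨c, g, a⟩ ⟨c', g', a'⟩ ⟨u, hu, hu'⟩
            dsimp at u hu hu' ⊢
            rw [hu, hu']
            exact congrFun (NatTrans.naturality_apply φ u.op g') a))
          left_inv := fun f => by
            ext x
            induction x using Quot.ind
            rfl
          right_inv := fun φ => by
            ext c g
            rfl }
      homEquiv_naturality_left_symm := fun f g => by
        ext x
        induction x using Quot.ind
        rfl
      homEquiv_naturality_right := fun f g => by
        ext c x
        rfl }

/-- `G ⊗_C A` is the colimit of `G` over the (opposite of the) category of elements of `A`. -/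
def tensorCocone (A : C ⥤ Type) (G : PSh C) : Cocone ((CategoryOfElements.π A).op ⋙ G) where
  pt := (tensor A).obj G
  ι :=
    { app := fun x => TypeCat.ofHom (fun g => Quot.mk _ ⟨x.unop.1, g, x.unop.2⟩)
      naturality := fun x y f => by
        ext g
        exact Quot.sound ⟨f.unop.1, rfl, f.unop.2.symm⟩ }

/-- The colimit property of `tensorCocone`. -/
def tensorIsColimit (A : C ⥤ Type) (G : PSh C) : IsColimit (tensorCocone A G) where
  desc s := TypeCat.ofHom (Quot.lift (fun x => s.ι.app (op ⟨x.1, x.2.2⟩) x.2.1) (by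
    rintro ⟨c, g, a⟩ ⟨c', g', a'⟩ ⟨u, hu, hu'⟩
    dsimp at u hu hu' ⊢
    rw [hu]
    let e : A.elementsMk c a ⟶ A.elementsMk c' a' := ⟨u, hu'.symm⟩
    exact ConcreteCategory.congr_hom (s.w e.op) g'))
  fac s j := by
    ext g
    rfl
  uniq s m hm := by
    ext x
    induction x using Quot.ind with
    | mk x => exact ConcreteCategory.congr_hom (hm (op ⟨x.1, x.2.2⟩)) x.2.1

/-- `- ⊗_C A` as a composite of restriction to the category of elements and colimit. -/
noncomputable def tensorIso (A : C ⥤ Type) :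
    tensor A ≅ (Functor.whiskeringLeft _ _ _).obj (CategoryOfElements.π A).op ⋙ colim :=
  NatIso.ofComponents
    (fun G => (tensorIsColimit A G).coconePointUniqueUpToIso (colimit.isColimit _))
    (fun {G H} φ => (tensorIsColimit A G).hom_ext (fun j => by
      have h1 := (tensorIsColimit A G).comp_coconePointUniqueUpToIso_hom (colimit.isColimit _) j
      have h2 := (tensorIsColimit A H).comp_coconePointUniqueUpToIso_hom (colimit.isColimit _) j
      have h3 := ι_colimMap (Functor.whiskerLeft (CategoryOfElements.π A).op φ) j
      ext g
      have e1 := ConcreteCategory.congr_hom h1 g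
      have e2 := ConcreteCategory.congr_hom h2 (φ.app _ g)
      have e3 := ConcreteCategory.congr_hom h3 g
      exact e2.trans (e3.symm.trans (congrArg
        (colimMap (Functor.whiskerLeft (CategoryOfElements.π A).op φ)) e1.symm))))

/-- If `A` is filtering, that is, if its category of elements is cofiltered, then `- ⊗_C A` is left
exact. -/
theorem tensor_leftExact (A : C ⥤ Type) [IsCofiltered A.Elements] :
    PreservesFiniteLimits (tensor A) :=
  haveI : PreservesFiniteLimits
      ((Functor.whiskeringLeft _ _ Type).obj (CategoryOfElements.π A).op ⋙ colim) :=
    comp_preservesFiniteLimits _ _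
  preservesFiniteLimits_of_natIso (tensorIso A).symm

/-- The point of the presheaf topos on `C` defined by a filtering (equivalently, flat) functor
`A : C ⥤ Type`, with inverse image `- ⊗_C A` and direct image `Hom_C(A, -)`. -/
def pointOfFlat (A : C ⥤ Type) [IsCofiltered A.Elements] : Point C where
  directImage := homFunctor A
  inverseImage := tensor A
  adj := tensorAdjunction A
  leftExact := tensor_leftExact A

end Tensor

/-! ## The monoid category `C`, the big cell `D` and the functor `π` -/

/-- The category `C` with one object whose monoid of endomorphisms is the multiplicative monoid of
strictly positive integers. -/
abbrev ArithCat := SingleObj ℕ+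

/-- An arrow of `C`, as a strictly positive integer. -/
def degree {x y : ArithCat} (f : x ⟶ y) : ℕ+ := f

/-- The big cell `D`: one object `[k]` for each strictly positive integer `k`. -/
structure BigCell where
  /-- the integer `k` of the object `[k]` -/
  val : ℕ+

/-- The partial ordering by reverse division: `[k] ≤ [l]` if and only if `l ∣ k`. -/
instance : PartialOrder BigCell where
  le k l := l.val ∣ k.val
  le_refl k := dvd_refl k.val
  le_trans _ _ _ h h' := dvd_trans h' h
  le_antisymm k l h h' := by
    cases k
    cases l
    exact congrArg _ (PNat.dvd_antisymm h' h)

/-- The functor `π : D ⥤ C`, sending the arrow `[k] ⟶ [l]` to the endomorphism `k / l`. -/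
def proj : BigCell ⥤ ArithCat where
  obj _ := SingleObj.star ℕ+
  map {k l} _ := PNat.divExact k.val l.val
  map_id k := by
    change PNat.divExact k.val k.val = 1
    exact mul_left_cancel ((PNat.mul_div_exact (dvd_refl k.val)).trans (mul_one _).symm)
  map_comp {k l m} f g := by
    have hlk : l.val ∣ k.val := leOfHom f
    have hml : m.val ∣ l.val := leOfHom g
    change PNat.divExact k.val m.val = PNat.divExact l.val m.val * PNat.divExact k.val l.val
    apply mul_left_cancel (a := m.val)
    rw [PNat.mul_div_exact (hml.trans hlk), ← mul_assoc, PNat.mul_div_exact hml,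
      PNat.mul_div_exact hlk]

/-! ## Supernatural numbers -/

/-- A supernatural number `∏ p ^ (s p)`, given by its exponents `s p ∈ ℕ ∪ {∞}`. -/
def Supernatural := Nat.Primes → ℕ∞

/-- `k ∣ s`: every prime exponent of `k` is at most the corresponding exponent of `s`. -/
def Supernatural.DividedBy (k : ℕ+) (s : Supernatural) : Prop :=
  ∀ p : Nat.Primes, ((k : ℕ).factorization p : ℕ∞) ≤ s p

/-- `s ∼ t` if `s` and `t` have the same infinite exponents, and all but finitely many of their
exponents agree. -/
instance supernaturalSetoid : Setoid Supernatural where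
  r s t := (∀ p, s p = ⊤ ↔ t p = ⊤) ∧ {p | s p ≠ t p}.Finite
  iseqv :=
    { refl := fun s => ⟨fun _ => Iff.rfl, by simp⟩
      symm := fun ⟨h, h'⟩ => ⟨fun p => (h p).symm, by simpa only [ne_comm] using h'⟩
      trans := fun {s t u} ⟨h, h'⟩ ⟨k, k'⟩ => ⟨fun p => (h p).trans (k p),
        (h'.union k').subset fun p hp => by
          by_contra hc
          simp only [Set.mem_union, Set.mem_ofPred_eq, not_or, not_not] at hc
          exact hp (hc.1.trans hc.2)⟩ }

theorem Supernatural.dividedBy_one (s : Supernatural) : DividedBy 1 s := by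
  intro p
  simp

theorem Supernatural.DividedBy.of_dvd {s : Supernatural} {k l : ℕ+} (h : DividedBy k s)
    (hl : l ∣ k) : DividedBy l s := by
  intro p
  refine le_trans ?_ (h p)
  have := (Nat.factorization_le_iff_dvd l.ne_zero k.ne_zero).2 (PNat.dvd_iff.1 hl) p
  exact_mod_cast this

theorem Supernatural.DividedBy.lcm {s : Supernatural} {k l : ℕ+} (hk : DividedBy k s)
    (hl : DividedBy l s) : DividedBy (PNat.lcm k l) s := by
  intro p
  rw [PNat.lcm_coe, Nat.factorization_lcm k.ne_zero l.ne_zero, Finsupp.sup_apply]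
  rcases le_total ((k : ℕ).factorization p) ((l : ℕ).factorization p) with h | h
  · rw [sup_eq_right.2 h]
    exact hl p
  · rw [sup_eq_left.2 h]
    exact hk p

/-! ## The point `p(s)` of the topos of presheaves on the big cell -/

/-- The covariant functor `P_s` on the big cell: a singleton on `[k]` if `k ∣ s`, and empty
otherwise. -/
def divisorFunctor (s : Supernatural) : BigCell ⥤ Type where
  obj k := PLift (s.DividedBy k.val)
  map f := TypeCat.ofHom (fun h => ⟨h.down.of_dvd (leOfHom f)⟩)

instance (s : Supernatural) : IsCofiltered (divisorFunctor s).Elements where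
  nonempty := ⟨⟨⟨1⟩, ⟨s.dividedBy_one⟩⟩⟩
  cone_objs := by
    rintro ⟨k, ⟨hk⟩⟩ ⟨l, ⟨hl⟩⟩
    refine ⟨⟨⟨PNat.lcm k.val l.val⟩, ⟨hk.lcm hl⟩⟩, ⟨homOfLE ?_, rfl⟩, ⟨homOfLE ?_, rfl⟩, trivial⟩
    · exact PNat.dvd_lcm_left _ _
    · exact PNat.dvd_lcm_right _ _
  cone_maps x y f g := ⟨x, 𝟙 x, Subtype.ext (Subsingleton.elim _ _)⟩

/-- The point `p(s)` of the topos of presheaves on the big cell. -/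
def bigCellPoint (s : Supernatural) : Point BigCell := pointOfFlat (divisorFunctor s)

/-! ## The point of the arithmetic site given by `ℚ₊(s)` -/

/-- The set `ℚ₊(s) = {n / k | n a strictly positive integer, k ∣ s}`. -/
def ratSet (s : Supernatural) : Set ℚ :=
  {q | ∃ n k : ℕ+, s.DividedBy k ∧ q = (n : ℚ) / (k : ℚ)}

/-- The set `ℚ₊(s)` with the left action of the strictly positive integers by multiplication, as a
covariant functor on `C`. -/
def ratFunctor (s : Supernatural) : ArithCat ⥤ Type where
  obj _ := ratSet s
  map n := TypeCat.ofHom (fun q => ⟨(degree n : ℚ) * q.1, by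
    obtain ⟨q, m, k, hk, rfl⟩ := q
    exact ⟨(degree n) * m, k, hk, by push_cast; ring⟩⟩)
  map_id _ := by
    ext q
    change ((1 : ℕ+) : ℚ) * q.1 = q.1
    simp
  map_comp m n := by
    ext q
    change (((degree n) * (degree m) : ℕ+) : ℚ) * q.1 = _ * (_ * q.1)
    push_cast
    ring

instance (s : Supernatural) : IsCofiltered (ratFunctor s).Elements where
  nonempty := ⟨⟨SingleObj.star ℕ+, ⟨1, 1, 1, s.dividedBy_one, by simp⟩⟩⟩
  cone_objs := by
    rintro ⟨⟨⟩, ⟨_, m, k, hk, rfl⟩⟩ ⟨⟨⟩, ⟨_, n, l, hl, rfl⟩⟩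
    obtain ⟨a, ha⟩ := PNat.dvd_lcm_left k l
    obtain ⟨b, hb⟩ := PNat.dvd_lcm_right k l
    refine ⟨⟨SingleObj.star ℕ+, ⟨_, 1, PNat.lcm k l, hk.lcm hl, rfl⟩⟩,
      ⟨(m * a : ℕ+), Subtype.ext ?_⟩, ⟨(n * b : ℕ+), Subtype.ext ?_⟩, trivial⟩
    · change ((m * a : ℕ+) : ℚ) * (((1 : ℕ+) : ℚ) / (PNat.lcm k l : ℕ+)) = m / k
      rw [ha]
      push_cast
      field_simp
    · change ((n * b : ℕ+) : ℚ) * (((1 : ℕ+) : ℚ) / (PNat.lcm k l : ℕ+)) = n / l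
      rw [hb]
      push_cast
      field_simp
  cone_maps := by
    rintro ⟨⟨⟩, ⟨q, hq⟩⟩ ⟨⟨⟩, ⟨r, hr⟩⟩ ⟨f, hf⟩ ⟨g, hg⟩
    refine ⟨_, 𝟙 _, congrArg _ (Subtype.ext ?_)⟩
    have h : (degree f : ℚ) * q = (degree g : ℚ) * q :=
      congrArg Subtype.val (hf.trans hg.symm)
    have hq0 : q ≠ 0 := by
      obtain ⟨m, k, -, rfl⟩ := hq
      positivity
    have h' := mul_right_cancel₀ hq0 h
    have h'' : degree f = degree g := by exact_mod_cast h'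
    exact h''

/-- The point of the arithmetic site defined by the flat functor `ℚ₊(s)`. -/
def arithmeticPoint (s : Supernatural) : Point ArithCat := pointOfFlat (ratFunctor s)

end ArithmeticSite

/-! By Diaconescu's theorem, a left exact left adjoint from presheaves to sets is `- ⊗ A`, where
`A`, its restriction along the Yoneda embedding, has a cofiltered category of elements. Classifying
points thus amounts to classifying filtering functors up to isomorphism.

On the poset `D` such a functor is subsingleton-valued, so it is determined by its support, a set of
integers containing 1 and closed under divisors and lcm. These sets are exactly the divisor sets of
supernatural numbers (`dividedBy_ofSet_iff`). On `C` it is a free action of ℕ+ in which any two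
elements are multiples of a common one. A base point in the role of 1 identifies it with ℚ₊(s),
where `s` records the integers dividing the base point. Changing the base point rescales by a
fraction, so ℚ₊(s) ≅ ℚ₊(t) exactly when `a s = b t` for some integers `a`, `b`, which is `s ∼ t`.

For the composite with `π` it suffices to evaluate on the single representable of `C`, where `n ⊗
[k] ↦ n / k` is a bijection onto ℚ₊(s) (`tensorDivisorIso`). -/

namespace ArithmeticSite

/-! ### Points of a presheaf topos are filtering functors -/

section Diaconescu

variable {C : Type} [SmallCategory C]

/-- An isomorphism of functors `A ≅ B` induces an isomorphism `- ⊗ A ≅ - ⊗ B`. -/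
def tensorCongr {A B : C ⥤ Type} (e : A ≅ B) : tensor A ≅ tensor B :=
  -- Left adjoints are unique, so it is enough to identify the right adjoints, by precomposition
  -- with `e`.
  (conjugateIsoEquiv (tensorAdjunction B) (tensorAdjunction A)).symm
    (NatIso.ofComponents (fun S => NatIso.ofComponents
      (fun c => (Equiv.arrowCongr (e.app c.unop).toEquiv.symm (Equiv.refl S)).toIso)
      (fun u => by
        ext f
        funext a
        exact congrArg f (NatTrans.naturality_apply e.hom u.unop a).symm))
      (fun h => by
        ext c f
        rfl))

/-- The tensor product with a representable presheaf is evaluation: `y(c) ⊗ A ≅ A(c)`. -/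
def yonedaTensorIso (A : C ⥤ Type) : yoneda ⋙ tensor A ≅ A :=
  NatIso.ofComponents
    (fun c =>
      { hom := TypeCat.ofHom (Quot.lift (fun x => A.map x.2.1 x.2.2) (by
          rintro ⟨d, g, a⟩ ⟨d', g', a'⟩ ⟨u, hu, hu'⟩
          dsimp at u g g' hu hu' ⊢
          rw [hu, hu', ← Functor.map_comp_apply]))
        inv := TypeCat.ofHom (fun a => Quot.mk _ ⟨c, 𝟙 c, a⟩)
        hom_inv_id := by
          ext x
          induction x using Quot.ind with
          | mk x =>
            obtain ⟨d, g, a⟩ := x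
            exact (Quot.sound ⟨g, (Category.comp_id g).symm, rfl⟩).symm
        inv_hom_id := by
          ext a
          exact Functor.map_id_apply A _ a })
    (fun {c d} f => by
      ext x
      induction x using Quot.ind with
      | mk x => exact Functor.map_comp_apply A _ _ _)

/-- A cocontinuous functor on a presheaf category with a right adjoint is the tensor product with
its restriction along the Yoneda embedding. -/
def isoTensorOfAdjunction {F : PSh C ⥤ Type} {R : Type ⥤ PSh C} (adj : F ⊣ R) :
    F ≅ tensor (yoneda ⋙ F) :=
  -- Again the right adjoints are compared: `Hom(F(y c), S) ≅ Hom(y c, R S) ≅ (R S)(c)`.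
  (conjugateIsoEquiv (tensorAdjunction (yoneda ⋙ F)) adj).symm
    (NatIso.ofComponents (fun S => NatIso.ofComponents
      (fun c => (TypeCat.homEquiv.symm.trans
        ((adj.homEquiv (yoneda.obj c.unop) S).trans yonedaEquiv)).toIso)
      (fun {c d} u => by
        ext f
        have h := adj.homEquiv_naturality_left (yoneda.map u.unop) (TypeCat.ofHom f)
        refine (congrArg yonedaEquiv h).trans ?_
        exact (yonedaEquiv_naturality _ u.unop).symm))
      (fun {S T} h => by
        ext c f
        exact congrArg yonedaEquiv (adj.homEquiv_naturality_right
          (X := yoneda.obj c.unop) (TypeCat.ofHom f) h)))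

/-- Isomorphic tensor functors come from isomorphic functors. -/
def isoOfTensorIso {A B : C ⥤ Type} (e : tensor A ≅ tensor B) : A ≅ B :=
  (yonedaTensorIso A).symm ≪≫ Functor.isoWhiskerLeft yoneda e ≪≫ yonedaTensorIso B

/-- The images of the elements of `F (y c)` under the elements of `G c` cover `F G`. -/
theorem exists_map_yonedaEquiv_symm_eq {F : PSh C ⥤ Type} {R : Type ⥤ PSh C} (adj : F ⊣ R)
    {G : PSh C} (x : F.obj G) :
    ∃ (c : C) (g : yoneda.obj c ⟶ G) (a : F.obj (yoneda.obj c)), F.map g a = x := by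
  -- `Prop` serves as subobject classifier: the characteristic map of the union of the images equals
  -- the constant map `True`, because their transposes `G ⟶ R Prop` agree on every element of `G`.
  let f₁ : F.obj G ⟶ Prop :=
    TypeCat.ofHom fun x => ∃ (c : C) (g : yoneda.obj c ⟶ G) (a : F.obj (yoneda.obj c)),
      F.map g a = x
  let f₂ : F.obj G ⟶ Prop := TypeCat.ofHom fun _ => True
  have h : f₁ = f₂ := by
    apply (adj.homEquiv G Prop).injective
    ext c y
    have key : yonedaEquiv.symm y ≫ adj.homEquiv G Prop f₁ =
        yonedaEquiv.symm y ≫ adj.homEquiv G Prop f₂ := by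
      rw [← adj.homEquiv_naturality_left, ← adj.homEquiv_naturality_left]
      congr 1
      ext a
      have : ∃ (c : C) (g : yoneda.obj c ⟶ G) (b : F.obj (yoneda.obj c)),
          F.map g b = F.map (yonedaEquiv.symm y) a := ⟨c.unop, _, a, rfl⟩
      exact iff_of_true this trivial
    have h' := congrArg yonedaEquiv key
    rwa [yonedaEquiv_comp, yonedaEquiv_comp, Equiv.apply_symm_apply] at h'
  have hx := ConcreteCategory.congr_hom h x
  exact of_eq_true hx

/-- The inverse image of a point, restricted along the Yoneda embedding, is filtering. -/
theorem Point.isCofiltered_elements (p : Point C) :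
    IsCofiltered (yoneda ⋙ p.inverseImage).Elements := by
  have := p.leftExact
  let F := p.inverseImage
  -- Left exactness supplies an element over the terminal object, a binary product or an equalizer
  -- of representables. `cover` lifts it to a representable, and full faithfulness of Yoneda yields
  -- the required arrows.
  have cover := fun {G : PSh C} (x : F.obj G) => exists_map_yonedaEquiv_symm_eq p.adj x
  have hne : Nonempty (yoneda ⋙ F).Elements := by
    let e : F.obj (⊤_ _) ≅ ⊤_ _ := PreservesTerminal.iso F
    obtain ⟨c, -, a, -⟩ := cover (e.inv default)
    exact ⟨⟨c, a⟩⟩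
  refine { nonempty := hne, cone_objs := ?_, cone_maps := ?_ }
  · rintro ⟨c, a⟩ ⟨d, b⟩
    have hl := mapIsLimitOfPreservesOfIsLimit F _ _
      (prodIsProd (yoneda.obj c) (yoneda.obj d))
    obtain ⟨l, hl₁, hl₂⟩ := BinaryFan.IsLimit.lift' hl
      (TypeCat.ofHom fun _ : PUnit.{1} => a) (TypeCat.ofHom fun _ : PUnit.{1} => b)
    obtain ⟨k, g, z, hz⟩ := cover (l PUnit.unit)
    refine ⟨⟨k, z⟩, ⟨yoneda.preimage (g ≫ prod.fst), ?_⟩,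
      ⟨yoneda.preimage (g ≫ prod.snd), ?_⟩, trivial⟩
    · have := ConcreteCategory.congr_hom hl₁ PUnit.unit
      change F.map (yoneda.map _) z = a
      rw [yoneda.map_preimage, Functor.map_comp_apply, hz]
      exact this
    · have := ConcreteCategory.congr_hom hl₂ PUnit.unit
      change F.map (yoneda.map _) z = b
      rw [yoneda.map_preimage, Functor.map_comp_apply, hz]
      exact this
  · rintro ⟨c, a⟩ ⟨d, b⟩ ⟨f, hf⟩ ⟨g, hg⟩
    have hl := isLimitForkMapOfIsLimit F _
      (equalizerIsEqualizer (yoneda.map f) (yoneda.map g))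
    obtain ⟨l, hl₁⟩ := Fork.IsLimit.lift' hl (TypeCat.ofHom fun _ : PUnit.{1} => a) (by
      ext
      exact hf.trans hg.symm)
    obtain ⟨k, u, z, hz⟩ := cover (l PUnit.unit)
    refine ⟨⟨k, z⟩, ⟨yoneda.preimage (u ≫ equalizer.ι _ _), ?_⟩, Subtype.ext ?_⟩
    · have := ConcreteCategory.congr_hom hl₁ PUnit.unit
      change F.map (yoneda.map _) z = a
      rw [yoneda.map_preimage, Functor.map_comp_apply, hz]
      exact this
    · apply yoneda.map_injective
      change yoneda.map (yoneda.preimage (u ≫ equalizer.ι (yoneda.map f) (yoneda.map g)) ≫ f) =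
        yoneda.map (yoneda.preimage (u ≫ equalizer.ι (yoneda.map f) (yoneda.map g)) ≫ g)
      simp only [Functor.map_comp, Functor.map_preimage, Category.assoc]
      exact congrArg (u ≫ ·) (equalizer.condition (yoneda.map f) (yoneda.map g))

/-- Points given by flat functors are isomorphic if and only if the flat functors are. -/
theorem pointOfFlat_equiv_iff (A B : C ⥤ Type) [IsCofiltered A.Elements]
    [IsCofiltered B.Elements] : pointOfFlat A ≈ pointOfFlat B ↔ Nonempty (A ≅ B) :=
  ⟨fun ⟨e⟩ => ⟨isoOfTensorIso e⟩, fun ⟨e⟩ => ⟨tensorCongr e⟩⟩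

end Diaconescu

/-! ### Supernatural numbers, their divisor sets and their equivalence -/

namespace Supernatural

theorem factorization_prime_pow (p q : Nat.Primes) (n : ℕ) :
    ((p : ℕ) ^ n).factorization q = if p = q then n else 0 := by
  rw [p.2.factorization_pow, Finsupp.single_apply]
  exact if_congr Subtype.ext_iff.symm rfl rfl

theorem factorization_pnat_prime_pow (p q : Nat.Primes) (n : ℕ) :
    (((p : ℕ+) ^ n : ℕ+) : ℕ).factorization q = if p = q then n else 0 := by
  rw [PNat.pow_coe, Nat.Primes.coe_pnat_nat]
  exact factorization_prime_pow p q n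

theorem dividedBy_prime_pow (s : Supernatural) (p : Nat.Primes) (n : ℕ) :
    s.DividedBy ((p : ℕ+) ^ n) ↔ (n : ℕ∞) ≤ s p := by
  constructor
  · intro h'
    have := h' p
    rwa [factorization_pnat_prime_pow, if_pos rfl] at this
  · intro h' q
    rw [factorization_pnat_prime_pow]
    split_ifs with hq
    · exact hq ▸ h'
    · simp

/-- Prime powers detect exponents, since an element of `ℕ∞`, even `⊤`, is determined by the naturals
below it. -/
theorem le_of_dividedBy_imp {s t : Supernatural} (h : ∀ k, s.DividedBy k → t.DividedBy k)
    (p : Nat.Primes) : s p ≤ t p :=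
  ENat.forall_natCast_le_iff_le.1 fun n hn =>
    (dividedBy_prime_pow t p n).1 (h _ ((dividedBy_prime_pow s p n).2 hn))

theorem eq_of_dividedBy_iff {s t : Supernatural} (h : ∀ k, s.DividedBy k ↔ t.DividedBy k) :
    s = t :=
  funext fun p => le_antisymm (le_of_dividedBy_imp (fun k => (h k).1) p)
    (le_of_dividedBy_imp (fun k => (h k).2) p)

/-- The supernatural number which is the least common multiple of a set of integers. -/
noncomputable def ofSet (K : Set ℕ+) : Supernatural :=
  fun p => ⨆ k ∈ K, ((k : ℕ).factorization p : ℕ∞)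

/-- A set of strictly positive integers containing `1` and closed under divisors and least common
multiples is the set of divisors of a supernatural number. -/
theorem dividedBy_ofSet_iff {K : Set ℕ+} (h₁ : 1 ∈ K)
    (hdvd : ∀ k l : ℕ+, k ∈ K → l ∣ k → l ∈ K)
    (hlcm : ∀ k l : ℕ+, k ∈ K → l ∈ K → PNat.lcm k l ∈ K) (k : ℕ+) :
    (ofSet K).DividedBy k ↔ k ∈ K := by
  refine ⟨fun h => ?_, fun h p => le_iSup₂_of_le k h le_rfl⟩
  have hex : ∀ p : Nat.Primes, ∃ l ∈ K, (k : ℕ).factorization p ≤ (l : ℕ).factorization p := by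
    intro p
    by_contra! hc
    -- Nonvanishing makes the truncated `- 1` below a genuine predecessor, so the supremum would
    -- fall strictly below the exponent of `k`.
    have hk : (k : ℕ).factorization p ≠ 0 := (Nat.zero_le _).trans_lt (hc 1 h₁) |>.ne'
    have : (ofSet K) p ≤ (((k : ℕ).factorization p - 1 : ℕ) : ℕ∞) :=
      iSup₂_le fun l hl => by
        have := hc l hl
        exact_mod_cast (by omega)
    have h' := (h p).trans this
    have h'' : (k : ℕ).factorization p ≤ (k : ℕ).factorization p - 1 := by exact_mod_cast h'
    omega
  choose l hlK hl using hex
  have hfin : ∀ S : Finset Nat.Primes, ∃ m ∈ K, ∀ p ∈ S, l p ∣ m := by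
    intro S
    induction S using Finset.cons_induction with
    | empty => exact ⟨1, h₁, by simp⟩
    | cons p S _ ih =>
      obtain ⟨m, hm, hS⟩ := ih
      refine ⟨PNat.lcm (l p) m, hlcm _ _ (hlK p) hm, fun q hq => ?_⟩
      rcases Finset.mem_cons.1 hq with rfl | hq
      · exact PNat.dvd_lcm_left _ _
      · exact (hS q hq).trans (PNat.dvd_lcm_right _ _)
  -- Only the finitely many primes dividing `k` matter, so one common multiple `m` in `K` dominates
  -- all exponents of `k`.
  obtain ⟨m, hm, hS⟩ := hfin ((k : ℕ).primeFactors.subtype Nat.Prime)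
  refine hdvd m k hm (PNat.dvd_iff.2 ((Nat.factorization_le_iff_dvd k.ne_zero m.ne_zero).1 ?_))
  intro p
  by_cases hp : p ∈ (k : ℕ).primeFactors
  · have hp' := Nat.prime_of_mem_primeFactors hp
    refine (hl ⟨p, hp'⟩).trans ?_
    exact (Nat.factorization_le_iff_dvd (l ⟨p, hp'⟩).ne_zero m.ne_zero).2
      (PNat.dvd_iff.1 (hS ⟨p, hp'⟩ (Finset.mem_subtype.2 hp))) p
  · rw [← Nat.support_factorization, Finsupp.notMem_support_iff] at hp
    omega

/-- Two supernatural numbers are equivalent if and only if they have a common multiple by strictly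
positive integers. -/
theorem equiv_iff_exists (s t : Supernatural) :
    s ≈ t ↔ ∃ a b : ℕ+, ∀ p : Nat.Primes,
      ((a : ℕ).factorization p : ℕ∞) + s p = ((b : ℕ).factorization p : ℕ∞) + t p := by
  constructor
  · rintro ⟨htop, hfin⟩
    -- `f u` is the part of `u` at the primes where `s` and `t` differ. Both exponents are finite
    -- there, so `toNat` loses nothing for `u = s` or `u = t`, and `f t · s = f s · t`.
    let f (u : Supernatural) : ℕ+ :=
      ∏ p ∈ hfin.toFinset, (p : ℕ+) ^ (u p).toNat
    have hf (u : Supernatural) (q : Nat.Primes) :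
        ((f u : ℕ+) : ℕ).factorization q = if s q ≠ t q then (u q).toNat else 0 := by
      have : ((f u : ℕ+) : ℕ) = ∏ p ∈ hfin.toFinset, (p : ℕ) ^ (u p).toNat := by
        refine (map_prod PNat.coeMonoidHom _ _).trans (Finset.prod_congr rfl fun p _ => ?_)
        exact PNat.pow_coe _ _
      rw [this, Nat.factorization_prod (fun p _ => pow_ne_zero _ p.2.ne_zero),
        Finset.sum_apply']
      simp only [factorization_prime_pow, Finset.sum_ite_eq']
      simp
    refine ⟨f t, f s, fun p => ?_⟩
    rw [hf, hf]
    by_cases h : s p = t p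
    · simp [h]
    · have hs : s p ≠ ⊤ := fun h' => h (h'.trans ((htop p).1 h').symm)
      have ht : t p ≠ ⊤ := fun h' => h (((htop p).2 h').trans h'.symm)
      rw [if_pos h, if_pos h, ENat.natCast_toNat hs, ENat.natCast_toNat ht, add_comm]
  · rintro ⟨a, b, h⟩
    refine ⟨fun p => ?_, ?_⟩
    · have := h p
      constructor
      · intro hs
        rw [hs, add_top] at this
        simpa using this.symm
      · intro ht
        rw [ht, add_top] at this
        simpa using this
    -- At a prime not dividing `a * b` the equation reduces to `s p = t p`.
    · refine (((a * b : ℕ+) : ℕ).primeFactors.subtype Nat.Prime).finite_toSet.subset ?_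
      intro p hp
      by_contra hc
      apply hp
      have hc' : ¬ ((p : ℕ) ∈ ((a * b : ℕ+) : ℕ).primeFactors) := by simpa using hc
      rw [PNat.mul_coe, Nat.primeFactors_mul a.ne_zero b.ne_zero, Finset.mem_union, not_or,
        ← Nat.support_factorization, ← Nat.support_factorization, Finsupp.notMem_support_iff,
        Finsupp.notMem_support_iff] at hc'
      simpa [hc'.1, hc'.2] using h p

end Supernatural

/-- A fraction `n / k` lies in `ℚ₊(s)` if and only if `k` divides `n s`. -/
theorem div_mem_ratSet_iff (s : Supernatural) (n k : ℕ+) :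
    (n : ℚ) / (k : ℚ) ∈ ratSet s ↔ ∀ p : Nat.Primes,
      ((k : ℕ).factorization p : ℕ∞) ≤ ((n : ℕ).factorization p : ℕ∞) + s p := by
  constructor
  · rintro ⟨m, l, hl, h⟩ p
    rw [div_eq_div_iff (by positivity) (by positivity)] at h
    have h' : (n : ℕ) * l = m * k := by exact_mod_cast h
    have h'' := congrArg (fun x => Nat.factorization x p) h'
    simp only [Nat.factorization_mul n.ne_zero l.ne_zero, Nat.factorization_mul m.ne_zero k.ne_zero,
      Finsupp.add_apply] at h''
    refine le_trans ?_ (add_le_add_right (hl p) _)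
    exact_mod_cast (by omega)
  · intro h
    -- In lowest terms each prime misses the numerator or the denominator, so the inequality reduces
    -- to `k' ∣ s`.
    obtain ⟨k', hk'⟩ := PNat.gcd_dvd_right n k
    obtain ⟨n', hn'⟩ := PNat.gcd_dvd_left n k
    set g := PNat.gcd n k with hg
    refine ⟨n', k', fun p => ?_, ?_⟩
    · have hcop : Nat.Coprime n' k' := by
        have h1 : (g : ℕ) = Nat.gcd (g * n') (g * k') := by
          rw [← PNat.mul_coe, ← PNat.mul_coe, ← hn', ← hk']
          exact PNat.gcd_coe n k
        rw [Nat.gcd_mul_left] at h1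
        exact Nat.eq_of_mul_eq_mul_left g.pos (by rw [← h1, mul_one])
      have hp := h p
      rw [hn', hk', PNat.mul_coe, PNat.mul_coe, Nat.factorization_mul g.ne_zero k'.ne_zero,
        Nat.factorization_mul g.ne_zero n'.ne_zero, Finsupp.add_apply, Finsupp.add_apply,
        Nat.cast_add, Nat.cast_add, add_assoc,
        ENat.add_le_add_iff_left (ENat.natCast_ne_top _)] at hp
      by_cases hpk : (p : ℕ) ∣ k'
      · have : ¬ (p : ℕ) ∣ n' := fun hpn => Nat.not_coprime_of_dvd_of_dvd p.2.one_lt hpn hpk hcop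
        rwa [Nat.factorization_eq_zero_of_not_dvd this, Nat.cast_zero, zero_add] at hp
      · rw [Nat.factorization_eq_zero_of_not_dvd hpk]
        simp
    · rw [hn', hk']
      push_cast
      field_simp

/-! ## Flat functors on the big cell -/

theorem eq_of_divisorFunctor_iso {s t : Supernatural}
    (e : divisorFunctor s ≅ divisorFunctor t) : s = t :=
  Supernatural.eq_of_dividedBy_iff fun k =>
    ⟨fun h => (e.hom.app ⟨k⟩ ⟨h⟩).down, fun h => (e.inv.app ⟨k⟩ ⟨h⟩).down⟩

/-- A filtering functor on the big cell takes values in subsingletons. -/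
theorem subsingleton_of_isCofiltered (A : BigCell ⥤ Type) [IsCofiltered A.Elements]
    (k : BigCell) : Subsingleton (A.obj k) := by
  refine ⟨fun a b => ?_⟩
  obtain ⟨⟨l, c⟩, ⟨f, hf⟩, ⟨g, hg⟩, -⟩ :=
    IsCofilteredOrEmpty.cone_objs (A.elementsMk k a) (A.elementsMk k b)
  -- Both elements are images of `c` under arrows of a poset, and parallel arrows coincide.
  exact hf.symm.trans ((congrArg (fun u => A.map u c) (Subsingleton.elim f g)).trans hg)

/-- Every filtering functor on the big cell is of the form `P_s`. -/
theorem exists_iso_divisorFunctor (A : BigCell ⥤ Type) [IsCofiltered A.Elements] :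
    ∃ s, Nonempty (A ≅ divisorFunctor s) := by
  have hsub := subsingleton_of_isCofiltered A
  let K : Set ℕ+ := {k | Nonempty (A.obj ⟨k⟩)}
  have hdvd : ∀ k l : ℕ+, k ∈ K → l ∣ k → l ∈ K := fun k l ⟨a⟩ h =>
    ⟨A.map (homOfLE (show (⟨k⟩ : BigCell) ≤ ⟨l⟩ from h)) a⟩
  have h₁ : 1 ∈ K := by
    obtain ⟨⟨⟨k⟩, a⟩⟩ := (inferInstance : IsCofiltered A.Elements).nonempty
    exact hdvd k 1 ⟨a⟩ (one_dvd k)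
  have hlcm : ∀ k l : ℕ+, k ∈ K → l ∈ K → PNat.lcm k l ∈ K := by
    rintro k l ⟨a⟩ ⟨b⟩
    obtain ⟨⟨⟨m⟩, c⟩, ⟨f, -⟩, ⟨g, -⟩, -⟩ :=
      IsCofilteredOrEmpty.cone_objs (A.elementsMk ⟨k⟩ a) (A.elementsMk ⟨l⟩ b)
    exact hdvd m _ ⟨c⟩ (PNat.lcm_dvd (leOfHom f) (leOfHom g))
  have hK := Supernatural.dividedBy_ofSet_iff h₁ hdvd hlcm
  refine ⟨Supernatural.ofSet K, ⟨NatIso.ofComponents (fun k =>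
    { hom := TypeCat.ofHom fun a => ⟨(hK k.val).2 ⟨a⟩⟩
      inv := TypeCat.ofHom fun h => ((hK k.val).1 h.down).some
      hom_inv_id := by
        ext a
        exact Subsingleton.elim _ _
      inv_hom_id := by
        ext a
        rfl }) (fun f => by
        ext a
        rfl)⟩⟩

/-! ## Flat functors on the arithmetic site -/

section Action

variable (A : ArithCat ⥤ Type)

/-- The action of a strictly positive integer on the set underlying a functor on `C`. -/
def act (n : ℕ+) (x : A.obj (SingleObj.star ℕ+)) : A.obj (SingleObj.star ℕ+) :=
  A.map (X := SingleObj.star ℕ+) (Y := SingleObj.star ℕ+) n x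

theorem act_act (m n : ℕ+) (x : A.obj (SingleObj.star ℕ+)) :
    act A m (act A n x) = act A (m * n) x :=
  (Functor.map_comp_apply A (X := SingleObj.star ℕ+) (Y := SingleObj.star ℕ+)
    (Z := SingleObj.star ℕ+) n m x).symm

theorem act_one (x : A.obj (SingleObj.star ℕ+)) : act A 1 x = x :=
  Functor.map_id_apply A (SingleObj.star ℕ+) x

/-- A natural isomorphism of functors on `C` from an equivariant bijection. -/
noncomputable def isoOfEquivariant {A B : ArithCat ⥤ Type}
    (f : A.obj (SingleObj.star ℕ+) → B.obj (SingleObj.star ℕ+)) (hf : Function.Bijective f)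
    (h : ∀ n x, f (act A n x) = act B n (f x)) : A ≅ B :=
  NatIso.ofComponents (fun _ => (Equiv.ofBijective f hf).toIso) (fun {X Y} n => by
    ext x
    exact h n x)

variable [IsCofiltered A.Elements]

theorem exists_act_eq_act_eq (x y : A.obj (SingleObj.star ℕ+)) :
    ∃ m n z, act A m z = x ∧ act A n z = y := by
  obtain ⟨⟨⟨⟩, z⟩, ⟨f, hf⟩, ⟨g, hg⟩, -⟩ := IsCofilteredOrEmpty.cone_objs
    (A.elementsMk (SingleObj.star ℕ+) x) (A.elementsMk (SingleObj.star ℕ+) y)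
  exact ⟨f, g, z, hf, hg⟩

/-- Freeness of the action: an arrow `f` equalizing `m` and `n` gives `m * f = n * f` in the
cancellative monoid ℕ+. -/
theorem act_injective_left {m n : ℕ+} {x : A.obj (SingleObj.star ℕ+)}
    (h : act A m x = act A n x) : m = n := by
  let u : A.elementsMk (SingleObj.star ℕ+) x ⟶ A.elementsMk (SingleObj.star ℕ+) (act A m x) :=
    ⟨m, rfl⟩
  let v : A.elementsMk (SingleObj.star ℕ+) x ⟶ A.elementsMk (SingleObj.star ℕ+) (act A m x) :=
    ⟨n, h.symm⟩
  obtain ⟨⟨⟨⟩, z⟩, ⟨f, hf⟩, hfg⟩ := IsCofilteredOrEmpty.cone_maps u v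
  have : m * degree f = n * degree f := congrArg Subtype.val hfg
  exact mul_right_cancel this

theorem act_injective_right {n : ℕ+} {x y : A.obj (SingleObj.star ℕ+)}
    (h : act A n x = act A n y) : x = y := by
  obtain ⟨k, l, z, rfl, rfl⟩ := exists_act_eq_act_eq A x y
  rw [act_act, act_act] at h
  rw [mul_left_cancel (act_injective_left A h)]

/-- Every filtering functor on `C` is of the form `ℚ₊(s)`. -/
theorem exists_iso_ratFunctor : ∃ s, Nonempty (A ≅ ratFunctor s) := by
  obtain ⟨⟨⟨⟩, a₀⟩⟩ := (inferInstance : IsCofiltered A.Elements).nonempty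
  change A.obj (SingleObj.star ℕ+) at a₀
  -- `a₀` will correspond to 1, so `K` is the set of allowed denominators. An element `x` with `n x
  -- = m a₀` goes to `m / n`.
  let K : Set ℕ+ := {k | ∃ c, act A k c = a₀}
  have hdvd : ∀ k l : ℕ+, k ∈ K → l ∣ k → l ∈ K := by
    rintro k l ⟨c, hc⟩ ⟨m, rfl⟩
    exact ⟨act A m c, by rw [act_act, hc]⟩
  have h₁ : 1 ∈ K := ⟨a₀, act_one A a₀⟩
  have hlcm : ∀ k l : ℕ+, k ∈ K → l ∈ K → PNat.lcm k l ∈ K := by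
    rintro k l ⟨c, hc⟩ ⟨d, hd⟩
    obtain ⟨m, n, e, rfl, rfl⟩ := exists_act_eq_act_eq A c d
    rw [act_act] at hc hd
    have : k * m = l * n := act_injective_left A (hc.trans hd.symm)
    exact hdvd (k * m) _ ⟨e, hc⟩ (PNat.lcm_dvd (dvd_mul_right _ _) (this ▸ dvd_mul_right _ _))
  have hK := Supernatural.dividedBy_ofSet_iff h₁ hdvd hlcm
  refine ⟨Supernatural.ofSet K, ?_⟩
  have hex : ∀ x, ∃ q : ratSet (Supernatural.ofSet K), ∃ m n : ℕ+,
      (q : ℚ) = (m : ℚ) / n ∧ act A n x = act A m a₀ := by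
    intro x
    obtain ⟨n, m, c, hn, hm⟩ := exists_act_eq_act_eq A a₀ x
    refine ⟨⟨_, m, n, (hK n).2 ⟨c, hn⟩, rfl⟩, m, n, rfl, ?_⟩
    rw [← hn, ← hm, act_act, act_act, mul_comm]
  choose f fm fn hf hact using hex
  -- Independence of the chosen `m`, `n`; surjectivity and equivariance both follow from it.
  have huniq : ∀ x (m n : ℕ+), act A n x = act A m a₀ → (f x : ℚ) = (m : ℚ) / n := by
    intro x m n h
    rw [hf, div_eq_div_iff (by positivity) (by positivity)]
    have h1 : act A (fm x * n) a₀ = act A (m * fn x) a₀ := by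
      rw [mul_comm, ← act_act, ← hact, act_act, mul_comm n, ← act_act, h, act_act, mul_comm]
    exact_mod_cast act_injective_left A h1
  refine ⟨isoOfEquivariant f ⟨fun x y hxy => ?_, ?_⟩ fun k x => Subtype.ext ?_⟩
  · have h := congrArg Subtype.val hxy
    rw [hf, hf, div_eq_div_iff (by positivity) (by positivity)] at h
    have h' : fm x * fn y = fm y * fn x := by exact_mod_cast h
    apply act_injective_right A (n := fn x * fn y)
    rw [mul_comm, ← act_act, hact, act_act, mul_comm, h', mul_comm (fn y), ← act_act _ (fn x),
      hact, act_act, mul_comm]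
  · rintro ⟨_, n, k, hk, rfl⟩
    obtain ⟨c, hc⟩ := (hK k).1 hk
    refine ⟨act A n c, Subtype.ext (huniq _ _ _ ?_)⟩
    rw [← hc, act_act, act_act, mul_comm]
  · refine (huniq _ (k * fm x) (fn x) ?_).trans ?_
    · rw [act_act, mul_comm, ← act_act, hact, act_act]
    · change _ = ((k : ℕ+) : ℚ) * (f x : ℚ)
      rw [hf]
      push_cast
      ring

end Action

/-- An isomorphism `ℚ₊(s) ≅ ℚ₊(t)` is multiplication by a fraction. -/
theorem exists_mul_mem_ratSet_iff {s t : Supernatural} (e : ratFunctor s ≅ ratFunctor t) :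
    ∃ a b : ℕ+, ∀ q : ℚ, q ∈ ratSet s ↔ (b : ℚ) / a * q ∈ ratSet t := by
  let φ : ratSet s → ratSet t := e.hom.app (SingleObj.star ℕ+)
  let ψ : ratSet t → ratSet s := e.inv.app (SingleObj.star ℕ+)
  have hφψ (y : ratSet t) : φ (ψ y) = y :=
    ConcreteCategory.congr_hom (e.inv_hom_id_app (SingleObj.star ℕ+)) y
  have hφ (n : ℕ+) (x y : ratSet s) (h : (y : ℚ) = n * x) : (φ y : ℚ) = n * φ x := by
    have hy : y = act (ratFunctor s) n x := Subtype.ext h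
    rw [hy]
    exact congrArg Subtype.val (NatTrans.naturality_apply e.hom
      (X := SingleObj.star ℕ+) (Y := SingleObj.star ℕ+) n x)
  have hmem (n : ℕ+) : (n : ℚ) ∈ ratSet s := ⟨n, 1, s.dividedBy_one, by simp⟩
  -- The fraction is `φ 1`: equivariance gives `k φ(n/k) = φ(n) = n φ(1)`.
  obtain ⟨b, a, -, hba⟩ := (φ ⟨_, hmem 1⟩).2
  have key (x : ratSet s) : (φ x : ℚ) = (b : ℚ) / a * x := by
    obtain ⟨_, n, k, hk, rfl⟩ := x
    have h1 := hφ n ⟨_, hmem 1⟩ ⟨_, hmem n⟩ (by simp)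
    have h2 := hφ k ⟨(n : ℚ) / k, n, k, hk, rfl⟩ ⟨_, hmem n⟩ (by
      change (n : ℚ) = k * ((n : ℚ) / k)
      field_simp)
    rw [h1, hba] at h2
    apply mul_left_cancel₀ (show (k : ℚ) ≠ 0 by positivity)
    rw [← h2]
    field_simp
  refine ⟨a, b, fun q => ⟨fun hq => key ⟨q, hq⟩ ▸ (φ ⟨q, hq⟩).2, fun hq => ?_⟩⟩
  have h := key (ψ ⟨_, hq⟩)
  rw [hφψ] at h
  rw [mul_left_cancel₀ (show (b : ℚ) / a ≠ 0 by positivity) h]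
  exact (ψ ⟨_, hq⟩).2

/-- The local statement at a prime `p`: the hypothesis compares membership of `p ^ i / p ^ j` in
ℚ₊(s) with that of its rescaling in ℚ₊(t). -/
theorem add_eq_add_of_forall_le_iff {a b : ℕ} {x y : ℕ∞}
    (h : ∀ i j : ℕ, (j : ℕ∞) ≤ i + x ↔ ((a + j : ℕ) : ℕ∞) ≤ (b + i : ℕ) + y) :
    (a : ℕ∞) + x = b + y := by
  apply le_antisymm <;> refine ENat.forall_natCast_le_iff_le.1 fun m hm => ?_
  -- Truncation is harmless, as `m ≤ a + (m - a)` always. The other direction takes `i = a` and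
  -- needs no subtraction.
  · have h1 : ((m - a : ℕ) : ℕ∞) ≤ ((0 : ℕ) : ℕ∞) + x := by
      rw [Nat.cast_zero, zero_add, ENat.natCast_sub]
      exact tsub_le_iff_left.2 hm
    refine le_trans ?_ ((h 0 (m - a)).1 h1)
    exact_mod_cast (by omega)
  · refine (h a m).2 ?_
    rw [Nat.add_comm b a, Nat.cast_add, Nat.cast_add, add_assoc]
    exact add_le_add_right hm _

theorem nonempty_ratFunctor_iso_iff (s t : Supernatural) :
    Nonempty (ratFunctor s ≅ ratFunctor t) ↔ s ≈ t := by
  rw [Supernatural.equiv_iff_exists]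
  have hmul (a b n k : ℕ+) : (b : ℚ) / a * ((n : ℚ) / k) = ((b * n : ℕ+) : ℚ) / (a * k : ℕ+) := by
    push_cast
    rw [div_mul_div_comm]
  have hfac (m n : ℕ+) (p : Nat.Primes) : ((m * n : ℕ+) : ℕ).factorization p =
      (m : ℕ).factorization p + (n : ℕ).factorization p := by
    rw [PNat.mul_coe, Nat.factorization_mul m.ne_zero n.ne_zero, Finsupp.add_apply]
  constructor
  · rintro ⟨e⟩
    obtain ⟨a, b, h⟩ := exists_mul_mem_ratSet_iff e
    refine ⟨a, b, fun p => add_eq_add_of_forall_le_iff fun i j => ?_⟩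
    -- `b / a` itself lies in ℚ₊(t), which settles the primes other than `p` when `p ^ i / p ^ j` is
    -- tested.
    have h1 := (div_mem_ratSet_iff t b a).1
      (by simpa using (h 1).1 ⟨1, 1, s.dividedBy_one, by simp⟩)
    have hij := h ((((p : ℕ+) ^ i : ℕ+) : ℚ) / ((p : ℕ+) ^ j : ℕ+))
    rw [hmul, div_mem_ratSet_iff, div_mem_ratSet_iff] at hij
    simp only [hfac, Supernatural.factorization_pnat_prime_pow] at hij
    constructor
    · intro hle
      have := hij.1 (fun q => by
        split_ifs with hq
        · exact hq ▸ hle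
        · simp) p
      rwa [if_pos rfl, if_pos rfl] at this
    · intro hle
      have := hij.2 (fun q => by
        split_ifs with hq
        · exact hq ▸ hle
        · exact h1 q) p
      rwa [if_pos rfl, if_pos rfl] at this
  · rintro ⟨a, b, h⟩
    have hiff (q : ℚ) (n k : ℕ+) (hq : q = (n : ℚ) / k) :
        q ∈ ratSet s ↔ (b : ℚ) / a * q ∈ ratSet t := by
      subst hq
      rw [hmul, div_mem_ratSet_iff, div_mem_ratSet_iff]
      refine forall_congr' fun p => ?_
      -- Substituting `h` leaves the exponent of `a` on both sides; being finite, it cancels in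
      -- `ℕ∞`.
      rw [hfac, hfac, Nat.cast_add, Nat.cast_add, add_right_comm, ← h, add_right_comm,
        add_assoc, ENat.add_le_add_iff_left (ENat.natCast_ne_top _)]
    refine ⟨isoOfEquivariant (A := ratFunctor s) (B := ratFunctor t)
      (fun q => ⟨(b : ℚ) / a * q.1, ?_⟩) ⟨fun x y hxy => ?_, ?_⟩ fun n x => Subtype.ext ?_⟩
    · obtain ⟨_, n, k, hk, rfl⟩ := q
      exact (hiff _ n k rfl).1 ⟨n, k, hk, rfl⟩
    · exact Subtype.ext (mul_left_cancel₀ (show (b : ℚ) / a ≠ 0 by positivity)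
        (congrArg Subtype.val hxy))
    · rintro ⟨_, n, k, hk, rfl⟩
      have hq : (b : ℚ) / a * (((a * n : ℕ+) : ℚ) / (b * k : ℕ+)) = (n : ℚ) / k := by
        push_cast
        field_simp
      exact ⟨⟨_, (hiff _ _ _ rfl).2 (hq ▸ ⟨n, k, hk, rfl⟩)⟩, Subtype.ext hq⟩
    · change (b : ℚ) / a * ((n : ℚ) * x.1) = (n : ℚ) * ((b : ℚ) / a * x.1)
      ring

/-! ## The composite with `π` -/

/-- The generator `[k] ⊗ n` of the set of arrows of `C` pulled back to the big cell and tensored with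
`P_s`. -/
def tensorDivisorMk (s : Supernatural) (n k : ℕ+) (hk : s.DividedBy k) :
    (yoneda ⋙ (inducedMorphism proj).inverseImage ⋙ tensor (divisorFunctor s)).obj
      (SingleObj.star ℕ+) :=
  Quot.mk _ ⟨⟨k⟩, n, ⟨hk⟩⟩

theorem exists_tensorDivisorMk_eq {s : Supernatural}
    (x : (yoneda ⋙ (inducedMorphism proj).inverseImage ⋙ tensor (divisorFunctor s)).obj
      (SingleObj.star ℕ+)) : ∃ n k hk, tensorDivisorMk s n k hk = x := by
  induction x using Quot.ind with
  | mk x => exact ⟨x.2.1, x.1.val, x.2.2.down, rfl⟩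

/-- Expanding a fraction by `m` is the tensor relation along `[k * m] ⟶ [k]`, which `π` sends to
`m`. -/
theorem tensorDivisorMk_mul {s : Supernatural} (n k m : ℕ+) (hk : s.DividedBy (k * m)) :
    tensorDivisorMk s (n * m) (k * m) hk =
      tensorDivisorMk s n k (hk.of_dvd (dvd_mul_right k m)) := by
  have hm : PNat.divExact (k * m) k = m :=
    mul_left_cancel (PNat.mul_div_exact (dvd_mul_right k m))
  refine Quot.sound ⟨homOfLE (show (⟨k * m⟩ : BigCell) ≤ ⟨k⟩ from dvd_mul_right k m), ?_, rfl⟩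
  change n * m = n * PNat.divExact (k * m) k
  rw [hm]

/-- The fraction `n / k` attached to `[k] ⊗ n`. -/
def tensorDivisorToRat (s : Supernatural) :
    (yoneda ⋙ (inducedMorphism proj).inverseImage ⋙ tensor (divisorFunctor s)).obj
      (SingleObj.star ℕ+) → ratSet s :=
  Quot.lift (fun x => ⟨((show ℕ+ from x.2.1) : ℚ) / (x.1.val : ℚ),
      x.2.1, x.1.val, x.2.2.down, rfl⟩) (by
    rintro ⟨⟨k⟩, m, hk⟩ ⟨⟨l⟩, n, hl⟩ ⟨u, hu, -⟩
    obtain ⟨r, rfl⟩ : l ∣ k := leOfHom u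
    have hr : PNat.divExact (l * r) l = r :=
      mul_left_cancel (PNat.mul_div_exact (dvd_mul_right l r))
    have hm : (show ℕ+ from m) = (show ℕ+ from n) * PNat.divExact (l * r) l := hu
    apply Subtype.ext
    dsimp only at hm ⊢
    have hq (x y z : ℕ+) : ((x * z : ℕ+) : ℚ) / (y * z : ℕ+) = (x : ℚ) / y := by
      push_cast
      field_simp
    rw [hm, hr]
    exact hq _ _ _)

/-- `ℚ₊(s)` is obtained by pulling back the representable presheaf on `C` to the big cell and
tensoring with `P_s`. -/
noncomputable def tensorDivisorIso (s : Supernatural) :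
    yoneda ⋙ (inducedMorphism proj).inverseImage ⋙ tensor (divisorFunctor s) ≅ ratFunctor s :=
  isoOfEquivariant (tensorDivisorToRat s)
    ⟨by
      intro x y hxy
      obtain ⟨m, k, hk, rfl⟩ := exists_tensorDivisorMk_eq x
      obtain ⟨n, l, hl, rfl⟩ := exists_tensorDivisorMk_eq y
      have h : (m : ℚ) / k = (n : ℚ) / l := congrArg Subtype.val hxy
      rw [div_eq_div_iff (by positivity) (by positivity)] at h
      have h' : m * l = n * k := by exact_mod_cast h
      -- Injectivity: both generators expand to the denominator `lcm k l`, which still divides `s`,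
      -- and there the numerators agree.
      obtain ⟨a, ha⟩ := PNat.dvd_lcm_left k l
      obtain ⟨b, hb⟩ := PNat.dvd_lcm_right k l
      have hs := hk.lcm hl
      have hab : k * a = l * b := ha.symm.trans hb
      have hmn : m * a = n * b := by
        apply mul_left_cancel (a := k * l)
        calc k * l * (m * a) = m * l * (k * a) := by ac_rfl
          _ = n * k * (l * b) := by rw [h', hab]
          _ = k * l * (n * b) := by ac_rfl
      rw [← tensorDivisorMk_mul m k a (ha ▸ hs), ← tensorDivisorMk_mul n l b (hb ▸ hs)]
      congr 1, by
      rintro ⟨_, n, k, hk, rfl⟩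
      exact ⟨tensorDivisorMk s n k hk, rfl⟩⟩
    (by
      intro n x
      obtain ⟨m, k, hk, rfl⟩ := exists_tensorDivisorMk_eq x
      apply Subtype.ext
      change ((n * m : ℕ+) : ℚ) / k = (n : ℚ) * ((m : ℚ) / k)
      rw [PNat.mul_coe, Nat.cast_mul, mul_div_assoc])

/-- The composite is the inverse image of a point, hence a left adjoint, so it is determined by its
restriction to representables, computed in `tensorDivisorIso`. -/
theorem nonempty_comp_inverseImage_iso (s : Supernatural) :
    Nonempty ((inducedMorphism proj).inverseImage ⋙ (bigCellPoint s).inverseImage ≅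
      tensor (ratFunctor s)) :=
  ⟨isoTensorOfAdjunction ((bigCellPoint s).comp (inducedMorphism proj)).adj ≪≫
    tensorCongr (tensorDivisorIso s)⟩

/-! ## Classification of points -/

theorem exists_pointOfFlat_equiv {C : Type} [SmallCategory C] (p : Point C) :
    ∃ (A : C ⥤ Type) (_ : IsCofiltered A.Elements), pointOfFlat A ≈ p :=
  ⟨yoneda ⋙ p.inverseImage, p.isCofiltered_elements, ⟨(isoTensorOfAdjunction p.adj).symm⟩⟩

theorem bijective_bigCellPoint :
    Function.Bijective fun s => (Quotient.mk _ (bigCellPoint s) : Pts BigCell) := by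
  constructor
  · intro s t h
    exact ((pointOfFlat_equiv_iff _ _).1 (Quotient.exact h)).elim eq_of_divisorFunctor_iso
  · intro x
    induction x using Quotient.inductionOn with
    | h p =>
      obtain ⟨A, _, hA⟩ := exists_pointOfFlat_equiv p
      obtain ⟨s, ⟨e⟩⟩ := exists_iso_divisorFunctor A
      exact ⟨s, Quotient.sound
        (Setoid.trans ((pointOfFlat_equiv_iff _ _).2 ⟨e.symm⟩) hA)⟩

theorem arithmeticPoint_equiv_iff (s t : Supernatural) :
    arithmeticPoint s ≈ arithmeticPoint t ↔ s ≈ t :=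
  (pointOfFlat_equiv_iff _ _).trans (nonempty_ratFunctor_iso_iff s t)

/-- The map from classes of supernatural numbers to points of the arithmetic site. -/
def arithmeticPts : Quotient supernaturalSetoid → Pts ArithCat :=
  Quotient.map arithmeticPoint fun s t => (arithmeticPoint_equiv_iff s t).2

theorem bijective_arithmeticPts : Function.Bijective arithmeticPts := by
  constructor
  · intro x y
    induction x, y using Quotient.inductionOn₂ with
    | h s t => exact fun h => Quotient.sound ((arithmeticPoint_equiv_iff s t).1 (Quotient.exact h))
  · intro x
    induction x using Quotient.inductionOn with
    | h p =>
      obtain ⟨A, _, hA⟩ := exists_pointOfFlat_equiv p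
      obtain ⟨s, ⟨e⟩⟩ := exists_iso_ratFunctor A
      exact ⟨Quotient.mk _ s, Quotient.sound
        (Setoid.trans ((pointOfFlat_equiv_iff _ _).2 ⟨e.symm⟩) hA)⟩

end ArithmeticSite

theorem mainTheorem4 :
    ∃ (e : ArithmeticSite.Supernatural ≃ ArithmeticSite.Pts ArithmeticSite.BigCell)
      (e' : Quotient ArithmeticSite.supernaturalSetoid ≃
        ArithmeticSite.Pts ArithmeticSite.ArithCat),
      (∀ s : ArithmeticSite.Supernatural,
        e s = Quotient.mk _ (ArithmeticSite.bigCellPoint s)) ∧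
      (∀ s : ArithmeticSite.Supernatural,
        e' (Quotient.mk _ s) = Quotient.mk _ (ArithmeticSite.arithmeticPoint s)) ∧
      (∀ s : ArithmeticSite.Supernatural,
        Nonempty ((ArithmeticSite.inducedMorphism ArithmeticSite.proj).inverseImage ⋙
            (ArithmeticSite.bigCellPoint s).inverseImage ≅
          ArithmeticSite.tensor (ArithmeticSite.ratFunctor s))) ∧
      (∀ s : ArithmeticSite.Supernatural,
        ArithmeticSite.Pts.map (ArithmeticSite.inducedMorphism ArithmeticSite.proj) (e s) =
          e' (Quotient.mk _ s)) := by
  refine ⟨Equiv.ofBijective _ ArithmeticSite.bijective_bigCellPoint,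
    Equiv.ofBijective _ ArithmeticSite.bijective_arithmeticPts, fun _ => rfl, fun _ => rfl,
    ArithmeticSite.nonempty_comp_inverseImage_iso, fun s => ?_⟩
  exact Quotient.sound (ArithmeticSite.nonempty_comp_inverseImage_iso s)
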